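/- Consider four bodies with masses $m_1,m_2,m_3,m_4>0$ at pairwise distinct points $q_1,q_2,q_3,q_4$ of the Euclidean plane $\mathbb{R}^2$, and put $r_{ij}=\|q_i-q_j\|$. Suppose that they form a central configuration of the Newtonian four-body problem, that is, for some $\lambda\in\mathbb{R}$, $$\lambda\, m_i\,(q_i-q_{CM})=\sum_{j\ne i}\frac{m_i m_j\,(q_j-q_i)}{r_{ij}^3},\qquad i=1,2,3,4,$$ where $q_{CM}=\frac{1}{m_1+m_2+m_3+m_4}\sum_{i} m_i q_i$. Suppose also that no three of the points are collinear, and that the configuration is either concave (one of the points lies strictly inside the convex hull of the other three) or standard convex (no point lies in the convex hull of the other three, and the points are numbered consecutively along the boundary of the convex quadrilateral that they form, so that its diagonals are $q_1q_3$ and $q_2q_4$). If the four points lie on a common circle, $m_1=m_2$ and $m_3=m_4$, then the configuration is an isosceles trapezoid with bases $q_1q_2$ and $q_3q_4$. That is, $q_1q_2q_3q_4$ is a convex quadrilateral whose vertices are in this order, the lines $q_1q_2$ and $q_3q_4$ are parallel, $r_{14}=r_{23}$, and $r_{13}=r_{24}$ (a square counts as an isosceles trapezoid). -/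

import Mathlib

open scoped Affine

/-- The Euclidean plane. -/
abbrev Plane : Type := EuclideanSpace ℝ (Fin 2)

/-- A configuration of four bodies in the plane; the bodies `1, 2, 3, 4` have the indices
`0, 1, 2, 3`. -/
abbrev PlanarConfig : Type := Fin 4 → Plane

/-- `q` is a central configuration of the Newtonian four-body problem with masses `m`:
the bodies are at distinct positions and, for some real `lam` and every `i`,
`lam * m i * (q i - q_CM) = ∑_{j ≠ i} m i * m j * (q j - q i) / r_ij ^ 3`,
where `q_CM` is the center of mass. -/
def IsCentralConfiguration (m : Fin 4 → ℝ) (q : PlanarConfig) : Prop :=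
  Function.Injective q ∧
    ∃ lam : ℝ, ∀ i : Fin 4,
      (lam * m i) • (q i - Finset.univ.centerMass m q) =
        ∑ j ∈ Finset.univ.erase i, (m i * m j / dist (q i) (q j) ^ 3) • (q j - q i)

/-- No two of the points coincide and no three of them are on a line. -/
def IsNondegenerate (q : PlanarConfig) : Prop :=
  Function.Injective q ∧
    ∀ i j k : Fin 4, i ≠ j → i ≠ k → j ≠ k → ¬ Collinear ℝ {q i, q j, q k}

/-- Non-degenerate, and one point lies strictly inside the convex hull of the other three. -/
def IsConcaveConfiguration (q : PlanarConfig) : Prop :=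
  IsNondegenerate q ∧ ∃ i : Fin 4, q i ∈ interior (convexHull ℝ (q '' {j | j ≠ i}))

/-- Non-degenerate, and no point lies in the convex hull of the other three. -/
def IsConvexConfiguration (q : PlanarConfig) : Prop :=
  IsNondegenerate q ∧ ∀ i : Fin 4, q i ∉ convexHull ℝ (q '' {j | j ≠ i})

/-- A convex configuration whose points are numbered consecutively along the boundary of
the quadrilateral: the segments `P₁P₃` and `P₂P₄` are the diagonals, that is, the two joining
segments that cross each other, and the other four joining segments are the sides. -/
def IsStandardConvexConfiguration (q : PlanarConfig) : Prop :=
  IsConvexConfiguration q ∧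
    (openSegment ℝ (q 0) (q 2) ∩ openSegment ℝ (q 1) (q 3)).Nonempty

/-- `P₁P₂P₃P₄` is an isosceles trapezoid with bases `P₁P₂` and `P₃P₄`: a convex quadrilateral
(vertices in this order) with parallel bases, legs of equal length and diagonals of equal length.
Squares are included; the condition on the diagonals rules out other parallelograms
than rectangles. -/
def IsIsoscelesTrapezoid (q : PlanarConfig) : Prop :=
  IsStandardConvexConfiguration q ∧
    line[ℝ, q 0, q 1] ∥ line[ℝ, q 2, q 3] ∧
    dist (q 0) (q 3) = dist (q 1) (q 2) ∧
    dist (q 0) (q 2) = dist (q 1) (q 3)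

/-! Write `S_ij = r_ij⁻³ - μ`, and let `D_i` be twice the signed area of the triangle omitting `q
i`. Wedging the equation of one body with a side joining it to another leaves two terms, and equal
masses cancel: `S02 D3 + S03 D2 = 0`, `S03 D1 + S13 D0 = 0`, `S02 D1 + S12 D0 = 0`. Eliminating
gives `S02 D3 D1 = S13 D0 D2` and `S03 D2 D1 = S12 D0 D3`. On a circle `2R|D|` is the product of the
sides of the triangle, and crossing diagonals give all `D_i` the same sign. Hence `S02 r02² = S13
r13²` and `S03 r03² = S12 r12²`. As `μ > 0`, `x⁻¹ - μx²` is strictly decreasing, so diagonals and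
legs are equal in pairs, which forces parallel bases. -/

/-- Twice the signed area of the triangle with vertices `a`, `b`, `c`. -/
noncomputable def twiceArea (a b c : Plane) : ℝ :=
  (b 0 - a 0) * (c 1 - a 1) - (b 1 - a 1) * (c 0 - a 0)

theorem Plane.dist_sq (a b : Plane) : dist a b ^ 2 = (a 0 - b 0) ^ 2 + (a 1 - b 1) ^ 2 := by
  rw [EuclideanSpace.dist_eq, Real.sq_sqrt (by positivity)]
  simp [Fin.sum_univ_two, Real.dist_eq, sq_abs]

/-- The circumradius formula for the area of a triangle, squared. -/
theorem sq_twiceArea_of_dist_eq {a b c o : Plane} {R : ℝ}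
    (ha : dist a o = R) (hb : dist b o = R) (hc : dist c o = R) :
    (2 * R * twiceArea a b c) ^ 2 = (dist a b * dist b c * dist a c) ^ 2 := by
  have ha' := Plane.dist_sq a o
  have hb' := Plane.dist_sq b o
  have hc' := Plane.dist_sq c o
  rw [ha] at ha'
  rw [hb] at hb'
  rw [hc] at hc'
  simp only [mul_pow, Plane.dist_sq]
  obtain ⟨D, hD⟩ : ∃ D, D = twiceArea a b c := ⟨_, rfl⟩
  -- Subtracting the circle equations gives a linear system for `o - a`; `hx` and `hy` are Cramer's
  -- rule.
  have hx : 2 * D * (o 0 - a 0) = ((b 0 - a 0) ^ 2 + (b 1 - a 1) ^ 2) * (c 1 - a 1)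
      - ((c 0 - a 0) ^ 2 + (c 1 - a 1) ^ 2) * (b 1 - a 1) := by
    rw [hD, twiceArea]
    linear_combination (c 1 - a 1) * (hb' - ha') - (b 1 - a 1) * (hc' - ha')
  have hy : 2 * D * (o 1 - a 1) = ((c 0 - a 0) ^ 2 + (c 1 - a 1) ^ 2) * (b 0 - a 0)
      - ((b 0 - a 0) ^ 2 + (b 1 - a 1) ^ 2) * (c 0 - a 0) := by
    rw [hD, twiceArea]
    linear_combination (b 0 - a 0) * (hc' - ha') - (c 0 - a 0) * (hb' - ha')
  rw [← hD, ha']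
  have h : 2 ^ 2 * ((a 0 - o 0) ^ 2 + (a 1 - o 1) ^ 2) * D ^ 2 =
      (2 * D * (o 0 - a 0)) ^ 2 + (2 * D * (o 1 - a 1)) ^ 2 := by ring
  rw [h, hx, hy]
  ring

/-- A point of a circle is not in the interior of the convex hull of other points of it. -/
theorem not_isConcaveConfiguration_of_cospherical {q : PlanarConfig}
    (hq : EuclideanGeometry.Cospherical (Set.range q)) : ¬ IsConcaveConfiguration q := by
  rintro ⟨⟨hinj, -⟩, i, hi⟩
  obtain ⟨o, R, h⟩ := hq
  have h' : ∀ j, dist (q j) o = R := fun j => h _ ⟨j, rfl⟩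
  have hR : R ≠ 0 := by
    rintro rfl
    have := hinj ((dist_eq_zero.1 (h' 0)).trans (dist_eq_zero.1 (h' 1)).symm)
    exact absurd this (by decide)
  have hsub : convexHull ℝ (q '' {j | j ≠ i}) ⊆ Metric.closedBall o R := by
    refine convexHull_min ?_ (convex_closedBall o R)
    rintro _ ⟨j, -, rfl⟩
    exact (h' j).le
  have := interior_mono hsub hi
  rw [interior_closedBall o hR, Metric.mem_ball, h'] at this
  exact lt_irrefl _ this

/-- The equations of a central configuration, with the multiplier absorbed in the
coefficients. -/
theorem IsCentralConfiguration.exists_sum_eq_zero {m : Fin 4 → ℝ} {q : PlanarConfig}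
    (hm : ∀ i, 0 < m i) (h : IsCentralConfiguration m q) :
    ∃ μ : ℝ, ∀ i k, ∑ j, m j * ((dist (q i) (q j) ^ 3)⁻¹ - μ) * (q j k - q i k) = 0 := by
  obtain ⟨-, lam, h⟩ := h
  have hM : 0 < ∑ j, m j := Finset.sum_pos (fun j _ => hm j) Finset.univ_nonempty
  -- With `M` the total mass, `q i - q_CM = -(1/M) ∑ m j (q j - q i)`, hence this `μ`. The added
  -- term `j = i` vanishes through the factor `q i - q i`.
  refine ⟨-lam / ∑ j, m j, fun i k => ?_⟩
  have hk := congrArg (fun v : Plane => v k) (h i)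
  have hsum : ∑ j ∈ Finset.univ.erase i, m i * m j / dist (q i) (q j) ^ 3 * (q j k - q i k)
      = m i * ∑ j, m j * (dist (q i) (q j) ^ 3)⁻¹ * (q j k - q i k) := by
    rw [Finset.mul_sum, ← Finset.sum_erase (a := i) Finset.univ (by simp)]
    exact Finset.sum_congr rfl fun j _ => by ring
  have hk' : lam * m i * (q i k - (∑ j, m j)⁻¹ * ∑ j, m j * q j k)
      = m i * ∑ j, m j * (dist (q i) (q j) ^ 3)⁻¹ * (q j k - q i k) := by
    rw [← hsum]
    simpa [Finset.centerMass] using hk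
  have hk'' := mul_left_cancel₀ (hm i).ne'
    ((by ring : m i * (lam * (q i k - (∑ j, m j)⁻¹ * ∑ j, m j * q j k)) = _).trans hk')
  have hsplit : ∑ j, m j * ((dist (q i) (q j) ^ 3)⁻¹ - -lam / ∑ j, m j) * (q j k - q i k)
      = ∑ j, m j * (dist (q i) (q j) ^ 3)⁻¹ * (q j k - q i k)
        + lam / (∑ j, m j) * (∑ j, m j * q j k - (∑ j, m j) * q i k) := by
    rw [Finset.sum_mul, ← Finset.sum_sub_distrib, Finset.mul_sum, ← Finset.sum_add_distrib]
    exact Finset.sum_congr rfl fun j _ => by ring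
  rw [hsplit, ← hk'']
  field_simp
  ring

/-- The signed areas of the four triangles of a crossing quadruple are proportional to the
coefficients of the crossing point. -/
theorem twiceArea_relations_of_crossing {q : PlanarConfig}
    (h : (openSegment ℝ (q 0) (q 2) ∩ openSegment ℝ (q 1) (q 3)).Nonempty) :
    ∃ s s' t t' : ℝ, 0 < s ∧ 0 < s' ∧ 0 < t ∧ 0 < t' ∧
      t' * twiceArea (q 0) (q 1) (q 3) = s' * twiceArea (q 0) (q 1) (q 2) ∧
      s * twiceArea (q 0) (q 2) (q 3) = t * twiceArea (q 1) (q 2) (q 3) ∧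
      t * twiceArea (q 0) (q 1) (q 2) = t' * twiceArea (q 0) (q 2) (q 3) := by
  obtain ⟨p, ⟨s, s', hs, hs', hss, h1⟩, ⟨t, t', ht, ht', htt, h2⟩⟩ := h
  have hk : ∀ k, s * q 0 k + s' * q 2 k = t * q 1 k + t' * q 3 k := fun k => by
    simpa using congrArg (fun v : Plane => v k) (h1.trans h2.symm)
  have h0 := hk 0
  have h1 := hk 1
  obtain rfl : s = 1 - s' := by linarith
  obtain rfl : t = 1 - t' := by linarith
  refine ⟨_, s', _, t', hs, hs', ht, ht', ?_, ?_, ?_⟩ <;> simp only [twiceArea]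
  -- The three relations are the crossing equation wedged with `q 1 - q 0`, `q 3 - q 2` and `q 2 - q
  -- 0`.
  · linear_combination (-(q 1 0 - q 0 0)) * h1 + (q 1 1 - q 0 1) * h0
  · linear_combination (q 3 0 - q 2 0) * h1 - (q 3 1 - q 2 1) * h0
  · linear_combination (q 2 0 - q 0 0) * h1 - (q 2 1 - q 0 1) * h0

/-- Strict monotonicity of `x ↦ (x⁻³ - μ) x²` for `μ > 0`, in the form of injectivity. -/
theorem eq_of_inv_cube_sub_mul_sq_eq {x y μ : ℝ} (hx : 0 < x) (hy : 0 < y) (hμ : 0 < μ)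
    (h : ((x ^ 3)⁻¹ - μ) * x ^ 2 = ((y ^ 3)⁻¹ - μ) * y ^ 2) : x = y := by
  have key : ∀ {u v : ℝ}, 0 < u → u < v →
      ((v ^ 3)⁻¹ - μ) * v ^ 2 < ((u ^ 3)⁻¹ - μ) * u ^ 2 := by
    intro u v hu huv
    have hv := hu.trans huv
    have e : ∀ {w : ℝ}, 0 < w → ((w ^ 3)⁻¹ - μ) * w ^ 2 = w⁻¹ - μ * w ^ 2 := by
      intro w hw
      field_simp
    rw [e hu, e hv]
    have h1 : v⁻¹ < u⁻¹ := by gcongr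
    have h2 : μ * u ^ 2 < μ * v ^ 2 := by gcongr
    linarith
  rcases lt_trichotomy x y with hxy | hxy | hxy
  · exact absurd h (key hx hxy).ne'
  · exact hxy
  · exact absurd h (key hy hxy).ne

/-- In a crossing quadruple, if the legs are equal and the diagonals are equal then the
bases are parallel. -/
theorem parallel_of_dist_eq {q : PlanarConfig} (h01 : q 0 ≠ q 1) (h23 : q 2 ≠ q 3)
    (hpos : 0 < twiceArea (q 0) (q 1) (q 2) * twiceArea (q 0) (q 1) (q 3))
    (hleg : dist (q 0) (q 3) = dist (q 1) (q 2)) (hdiag : dist (q 0) (q 2) = dist (q 1) (q 3)) :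
    line[ℝ, q 0, q 1] ∥ line[ℝ, q 2, q 3] := by
  have hl := congrArg (· ^ 2) hleg
  have hd := congrArg (· ^ 2) hdiag
  simp only [Plane.dist_sq] at hl hd
  -- The vector joining the midpoints of the bases is orthogonal to both (`hu`, `hv`). If they were
  -- not parallel, the midpoints would coincide, putting `q 2` and `q 3` on opposite sides of `q 0 q
  -- 1`, against `hpos`.
  have hcross : (q 0 0 - q 1 0) * (q 2 1 - q 3 1) = (q 0 1 - q 1 1) * (q 2 0 - q 3 0) := by
    by_contra hne
    have hne' := sub_ne_zero.2 hne
    have hu : (q 2 0 + q 3 0 - q 0 0 - q 1 0) * (q 0 0 - q 1 0)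
        + (q 2 1 + q 3 1 - q 0 1 - q 1 1) * (q 0 1 - q 1 1) = 0 := by
      linear_combination (-1 / 2) * hl - (1 / 2) * hd
    have hv : (q 2 0 + q 3 0 - q 0 0 - q 1 0) * (q 2 0 - q 3 0)
        + (q 2 1 + q 3 1 - q 0 1 - q 1 1) * (q 2 1 - q 3 1) = 0 := by
      linear_combination (-1 / 2) * hl + (1 / 2) * hd
    have hx : q 2 0 + q 3 0 - q 0 0 - q 1 0 = 0 := by
      refine (mul_eq_zero.1 ?_).resolve_left hne'
      linear_combination (q 2 1 - q 3 1) * hu - (q 0 1 - q 1 1) * hv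
    have hy : q 2 1 + q 3 1 - q 0 1 - q 1 1 = 0 := by
      refine (mul_eq_zero.1 ?_).resolve_left hne'
      linear_combination (q 0 0 - q 1 0) * hv - (q 2 0 - q 3 0) * hu
    have : twiceArea (q 0) (q 1) (q 3) = -twiceArea (q 0) (q 1) (q 2) := by
      simp only [twiceArea]
      linear_combination (q 1 0 - q 0 0) * hy - (q 1 1 - q 0 1) * hx
    rw [this] at hpos
    nlinarith [sq_nonneg (twiceArea (q 0) (q 1) (q 2))]
  rw [AffineSubspace.affineSpan_pair_parallel_iff_vectorSpan_eq, vectorSpan_pair, vectorSpan_pair]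
  have hN : 0 < (q 2 0 - q 3 0) ^ 2 + (q 2 1 - q 3 1) ^ 2 := by
    rw [← Plane.dist_sq]
    exact pow_pos (dist_pos.2 h23) 2
  obtain ⟨c, hc⟩ : ∃ c : ℝ, q 0 - q 1 = c • (q 2 - q 3) := by
    refine ⟨((q 0 0 - q 1 0) * (q 2 0 - q 3 0) + (q 0 1 - q 1 1) * (q 2 1 - q 3 1)) /
      ((q 2 0 - q 3 0) ^ 2 + (q 2 1 - q 3 1) ^ 2), ?_⟩
    ext k
    fin_cases k
    · simp only [Fin.zero_eta, PiLp.sub_apply, PiLp.smul_apply, smul_eq_mul]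
      field_simp
      linear_combination (q 2 1 - q 3 1) * hcross
    · simp only [Fin.mk_one, PiLp.sub_apply, PiLp.smul_apply, smul_eq_mul]
      field_simp
      linear_combination (-(q 2 0 - q 3 0)) * hcross
  have hc0 : c ≠ 0 := by
    rintro rfl
    exact h01 (sub_eq_zero.1 (by simpa using hc))
  rw [vsub_eq_sub, vsub_eq_sub, hc]
  exact Submodule.span_singleton_smul_eq (IsUnit.mk0 c hc0) _

/-- A product of two areas of triangles in a circle, without a sign ambiguity. -/
theorem mul_eq_of_sq_eq {R D E u v : ℝ} (hDE : 0 < D * E) (hu : 0 < u) (hv : 0 < v)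
    (hD : (2 * R * D) ^ 2 = u ^ 2) (hE : (2 * R * E) ^ 2 = v ^ 2) :
    4 * R ^ 2 * (D * E) = u * v := by
  refine (sq_eq_sq₀ (by positivity) (by positivity)).1 ?_
  rw [mul_pow u v, ← hD, ← hE]
  ring

theorem mainTheorem3 (m : Fin 4 → ℝ) (q : PlanarConfig)
    (hm : ∀ i, 0 < m i)
    (hcc : IsCentralConfiguration m q)
    (hshape : IsConcaveConfiguration q ∨ IsStandardConvexConfiguration q)
    (hcirc : EuclideanGeometry.Concyclic (Set.range q))
    (h12 : m 0 = m 1) (h34 : m 2 = m 3) :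
    IsIsoscelesTrapezoid q := by
  have hstd := hshape.resolve_left (not_isConcaveConfiguration_of_cospherical hcirc.1)
  have hd : ∀ i j, i ≠ j → 0 < dist (q i) (q j) := fun i j hij => dist_pos.2 (hcc.1.ne hij)
  have ha := hd 0 1 (by decide)
  have hb := hd 1 2 (by decide)
  have hc := hd 2 3 (by decide)
  have hd' := hd 0 3 (by decide)
  have he := hd 0 2 (by decide)
  have hf := hd 1 3 (by decide)
  obtain ⟨o, R, ho⟩ := hcirc.1
  have ho' : ∀ j, dist (q j) o = R := fun j => ho _ ⟨j, rfl⟩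
  have hA3 := sq_twiceArea_of_dist_eq (ho' 0) (ho' 1) (ho' 2)
  have hA2 := sq_twiceArea_of_dist_eq (ho' 0) (ho' 1) (ho' 3)
  have hA1 := sq_twiceArea_of_dist_eq (ho' 0) (ho' 2) (ho' 3)
  have hA0 := sq_twiceArea_of_dist_eq (ho' 1) (ho' 2) (ho' 3)
  obtain ⟨s, s', t, t', hs, hs', ht, ht', h1, h2, h3⟩ := twiceArea_relations_of_crossing hstd.2
  obtain ⟨μ, hμ⟩ := hcc.exists_sum_eq_zero hm
  have e1 : ((dist (q 0) (q 2) ^ 3)⁻¹ - μ) * twiceArea (q 0) (q 1) (q 2)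
      + ((dist (q 0) (q 3) ^ 3)⁻¹ - μ) * twiceArea (q 0) (q 1) (q 3) = 0 := by
    have hx := hμ 0 0
    have hy := hμ 0 1
    simp only [Fin.sum_univ_four, ← h34] at hx hy
    refine (mul_eq_zero.1 ?_).resolve_left (hm 2).ne'
    simp only [twiceArea]
    linear_combination (q 1 0 - q 0 0) * hy - (q 1 1 - q 0 1) * hx
  have e2 : ((dist (q 0) (q 3) ^ 3)⁻¹ - μ) * twiceArea (q 0) (q 2) (q 3)
      + ((dist (q 1) (q 3) ^ 3)⁻¹ - μ) * twiceArea (q 1) (q 2) (q 3) = 0 := by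
    have hx := hμ 3 0
    have hy := hμ 3 1
    simp only [Fin.sum_univ_four, ← h12, dist_comm (q 3)] at hx hy
    refine (mul_eq_zero.1 ?_).resolve_left (hm 0).ne'
    simp only [twiceArea]
    linear_combination (-(q 2 0 - q 3 0)) * hy + (q 2 1 - q 3 1) * hx
  have e3 : ((dist (q 0) (q 2) ^ 3)⁻¹ - μ) * twiceArea (q 0) (q 2) (q 3)
      + ((dist (q 1) (q 2) ^ 3)⁻¹ - μ) * twiceArea (q 1) (q 2) (q 3) = 0 := by
    have hx := hμ 2 0
    have hy := hμ 2 1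
    simp only [Fin.sum_univ_four, ← h12, dist_comm (q 2) (q 0), dist_comm (q 2) (q 1)] at hx hy
    refine (mul_eq_zero.1 ?_).resolve_left (hm 0).ne'
    simp only [twiceArea]
    linear_combination (q 3 0 - q 2 0) * hy - (q 3 1 - q 2 1) * hx
  have hne : twiceArea (q 0) (q 1) (q 2) ≠ 0 := by
    intro h0
    rw [h0, mul_zero, zero_pow two_ne_zero] at hA3
    exact (show (0 : ℝ) < (dist (q 0) (q 1) * dist (q 1) (q 2) * dist (q 0) (q 2)) ^ 2 by
      positivity).ne hA3
  -- Instantiated before the areas become opaque variables, so that its area hypothesis is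
  -- generalized with them.
  have hpl := parallel_of_dist_eq (hcc.1.ne (by decide : (0 : Fin 4) ≠ 1))
    (hcc.1.ne (by decide : (2 : Fin 4) ≠ 3))
  generalize twiceArea (q 0) (q 1) (q 2) = D3 at *
  generalize twiceArea (q 0) (q 1) (q 3) = D2 at *
  generalize twiceArea (q 0) (q 2) (q 3) = D1 at *
  generalize twiceArea (q 1) (q 2) (q 3) = D0 at *
  obtain ⟨c2, hc2, rfl⟩ : ∃ c, 0 < c ∧ D2 = c * D3 :=
    ⟨s' / t', by positivity, by field_simp; linarith⟩
  obtain ⟨c1, hc1, rfl⟩ : ∃ c, 0 < c ∧ D1 = c * D3 :=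
    ⟨t / t', by positivity, by field_simp; linarith⟩
  obtain ⟨c0, hc0, rfl⟩ : ∃ c, 0 < c ∧ D0 = c * D3 :=
    ⟨s * c1 / t, by positivity, by field_simp; linarith⟩
  have hsq : 0 < D3 ^ 2 := by positivity
  have hpos : ∀ {x y : ℝ}, 0 < x → 0 < y → 0 < (x * D3) * (y * D3) := fun {x y} hx hy => by
    have : 0 < x * y * D3 ^ 2 := by positivity
    linarith
  have p32 : 0 < D3 * (c2 * D3) := by simpa using hpos one_pos hc2
  have p31 : 0 < D3 * (c1 * D3) := by simpa using hpos one_pos hc1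
  have p30 : 0 < D3 * (c0 * D3) := by simpa using hpos one_pos hc0
  -- Otherwise every `S_ij` is positive, and `e1` is a nonzero multiple of `D3`.
  have hμ0 : 0 < μ := by
    by_contra! hμ'
    have hp : 0 < ((dist (q 0) (q 2) ^ 3)⁻¹ - μ) + ((dist (q 0) (q 3) ^ 3)⁻¹ - μ) * c2 := by
      have i1 : 0 < (dist (q 0) (q 2) ^ 3)⁻¹ := by positivity
      have i2 : 0 < (dist (q 0) (q 3) ^ 3)⁻¹ := by positivity
      have := mul_pos (show 0 < (dist (q 0) (q 3) ^ 3)⁻¹ - μ by linarith) hc2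
      linarith
    exact mul_ne_zero hp.ne' hne (by linear_combination e1)
  have r31 := mul_eq_of_sq_eq p31 (by positivity) (by positivity) hA3 hA1
  have r02 := mul_eq_of_sq_eq (hpos hc0 hc2) (by positivity) (by positivity) hA0 hA2
  have r21 := mul_eq_of_sq_eq (hpos hc2 hc1) (by positivity) (by positivity) hA2 hA1
  have r30 := mul_eq_of_sq_eq p30 (by positivity) (by positivity) hA3 hA0
  have hdiag : dist (q 0) (q 2) = dist (q 1) (q 3) := by
    refine eq_of_inv_cube_sub_mul_sq_eq he hf hμ0 ?_
    -- The product of the four sides divides both chord products; `D1 * e1 - D2 * e2` eliminates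
    -- `S03`.
    refine mul_left_cancel₀ (show dist (q 0) (q 1) * dist (q 1) (q 2) * dist (q 2) (q 3) *
      dist (q 0) (q 3) ≠ 0 by positivity) ?_
    linear_combination (-((dist (q 0) (q 2) ^ 3)⁻¹ - μ)) * r31
      + ((dist (q 1) (q 3) ^ 3)⁻¹ - μ) * r02 + 4 * R ^ 2 * (c1 * D3 * e1 - c2 * D3 * e2)
  have hleg : dist (q 0) (q 3) = dist (q 1) (q 2) := by
    refine eq_of_inv_cube_sub_mul_sq_eq hd' hb hμ0 ?_
    -- Here the common factor is bases times diagonals; `D1 * e1 - D3 * e3` eliminates `S02`.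
    refine mul_left_cancel₀ (show dist (q 0) (q 1) * dist (q 2) (q 3) * dist (q 0) (q 2) *
      dist (q 1) (q 3) ≠ 0 by positivity) ?_
    linear_combination (-((dist (q 0) (q 3) ^ 3)⁻¹ - μ)) * r21
      + ((dist (q 1) (q 2) ^ 3)⁻¹ - μ) * r30 + 4 * R ^ 2 * (c1 * D3 * e1 - D3 * e3)
  exact ⟨hstd, hpl p32 hleg hdiag, hleg, hdiag⟩
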